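/- A parallel architecture of depth $d$ on $n$ qubits ($n$ even) prescribes, for each layer $m=1,\dots,d$, an arbitrary partition of the $n$ qubits into disjoint pairs (which may change from layer to layer), so that every qubit takes part in exactly one two-qubit gate per layer. The associated noiseless Haar-random circuit ensemble $\mathcal B$ consists of the unitaries $U=U_dU_{d-1}\cdots U_1$ on $(\mathbb C^2)^{\otimes n}$, where $U_m$ is the tensor product, over the pairs of layer $m$, of two-qubit gates, and all the gates of the circuit are drawn independently from the Haar probability measure on $U(4)$. **Theorem.** Let $(n_k)_{k\in\mathbb N}$ be a sequence of even numbers with $n_k\to\infty$, and let $d_k\ge 1$ be integers of sublogarithmic growth, i.e. $d_k=o(\log n_k)$ as $k\to\infty$ (this holds in particular if $d_k=O((\log n_k)^a)$ for a fixed $0\le a<1$). For every $k$, let an arbitrary parallel architecture of depth $d_k$ on $n_k$ qubits be given, with noiseless Haar-random circuit ensemble $\mathcal B_k$. Then $$\lim_{k\to\infty}\ \Pr_{U\sim\mathcal B_k}\left[\ \left|\langle 00\ldots0|U|00\ldots0\rangle\right|^2\ \ge\ \frac{1}{2^{n_k}\,e^{\,n_k/(8\cdot 30^{d_k})}}\ \right]=0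 .$$ -/

import Mathlib

open Filter Topology MeasureTheory Asymptotics

namespace RandomCircuit

/-- The group `U(4)` of two-qubit gates; the computational basis is indexed by pairs of bits. -/
abbrev TwoQubitGate : Type := Matrix.unitaryGroup (Fin 2 × Fin 2) ℂ

instance : IsTopologicalGroup TwoQubitGate :=
  inferInstanceAs (IsTopologicalGroup (unitary (Matrix (Fin 2 × Fin 2) (Fin 2 × Fin 2) ℂ)))

instance : CompactSpace TwoQubitGate := by
  have hc : IsClosed (Matrix.unitaryGroup (Fin 2 × Fin 2) ℂ :
      Set (Matrix (Fin 2 × Fin 2) (Fin 2 × Fin 2) ℂ)) := by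
    have h : (Matrix.unitaryGroup (Fin 2 × Fin 2) ℂ :
        Set (Matrix (Fin 2 × Fin 2) (Fin 2 × Fin 2) ℂ)) = {A | A * star A = 1} := by
      ext A
      exact Matrix.mem_unitaryGroup_iff
    rw [h]
    exact isClosed_eq (by fun_prop) continuous_const
  have hK : IsCompact (Set.univ.pi fun _ : Fin 2 × Fin 2 =>
      Set.univ.pi fun _ : Fin 2 × Fin 2 => Metric.closedBall (0 : ℂ) 1) :=
    isCompact_univ_pi fun _ => isCompact_univ_pi fun _ => isCompact_closedBall _ _
  refine isCompact_iff_compactSpace.mp (hK.of_isClosed_subset hc ?_)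
  intro A hA i _ j _
  simpa using entry_norm_bound_of_unitary hA i j

noncomputable instance : MeasurableSpace TwoQubitGate := borel _

instance : BorelSpace TwoQubitGate := ⟨rfl⟩

/-- The Haar probability measure on `U(4)`, i.e. the Haar measure of total mass one. -/
noncomputable def haarGate : Measure TwoQubitGate := Measure.haarMeasure ⊤

instance : IsProbabilityMeasure haarGate := ⟨by
  have h := Measure.haarMeasure_self (K₀ := (⊤ : TopologicalSpace.PositiveCompacts TwoQubitGate))
  simpa [haarGate] using h⟩

/-- A parallel architecture of depth `d` on `n` qubits: in each of the `d` layers the qubits are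
grouped into disjoint pairs, so that every qubit takes part in exactly one two-qubit gate.
The grouping is encoded by the map sending a qubit to its partner and may change arbitrarily from
layer to layer. (If `1 ≤ d`, this forces `n` to be even.) -/
structure ParallelArchitecture (n d : ℕ) where
  partner : Fin d → Fin n → Fin n
  partner_partner : ∀ m i, partner m (partner m i) = i
  partner_ne : ∀ m i, partner m i ≠ i

namespace ParallelArchitecture

variable {n d : ℕ}

/-- The gates of layer `m`, one for each pair, named by the smaller qubit of the pair. -/
abbrev LayerGate (A : ParallelArchitecture n d) (m : Fin d) : Type :=
  {i : Fin n // i < A.partner m i}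

/-- The places in the circuit that have to be filled with a two-qubit gate. -/
abbrev Gate (A : ParallelArchitecture n d) : Type := Σ m : Fin d, A.LayerGate m

/-- The unitary of layer `m`, in the computational basis of `n` qubits (indexed by bit strings):
the tensor product over the pairs `{i, partner i}`, `i < partner i`, of the gate placed there.
The first tensor factor of a gate acts on `i` and the second one on `partner i`. -/
noncomputable def layer (A : ParallelArchitecture n d) (g : A.Gate → TwoQubitGate) (m : Fin d) :
    Matrix (Fin n → Fin 2) (Fin n → Fin 2) ℂ :=
  Matrix.of fun x y => ∏ i : A.LayerGate m,
    (g ⟨m, i⟩ : Matrix (Fin 2 × Fin 2) (Fin 2 × Fin 2) ℂ)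
      (x i, x (A.partner m i)) (y i, y (A.partner m i))

/-- The unitary `U = U_d ⋯ U_2 U_1` implemented by the circuit. -/
noncomputable def circuit (A : ParallelArchitecture n d) (g : A.Gate → TwoQubitGate) :
    Matrix (Fin n → Fin 2) (Fin n → Fin 2) ℂ :=
  (List.ofFn (A.layer g)).reverse.prod

/-- The probability `|⟨00…0|U|00…0⟩|²` of the output `00…0` of the noiseless circuit. -/
noncomputable def zeroProb (A : ParallelArchitecture n d) (g : A.Gate → TwoQubitGate) : ℝ :=
  ‖A.circuit g 0 0‖ ^ 2

/-- The noiseless Haar-random circuit ensemble: the gates are independent and Haar distributed. -/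
noncomputable def haarEnsemble (A : ParallelArchitecture n d) : Measure (A.Gate → TwoQubitGate) :=
  Measure.pi fun _ => haarGate

instance (A : ParallelArchitecture n d) : IsProbabilityMeasure A.haarEnsemble := by
  unfold haarEnsemble
  infer_instance

end ParallelArchitecture

/-- Depth `d k` is sublogarithmic in the number `n k` of qubits: `d = o(log n)`. -/
def IsSublogarithmic (n d : ℕ → ℕ) : Prop :=
  (fun k => (d k : ℝ)) =o[atTop] fun k => Real.log (n k)

/-- The scaling `d = O((log n)^a)` with a fixed `a < 1`, as `n → ∞`, is sublogarithmic. -/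
theorem IsSublogarithmic.of_isBigO_rpow {n d : ℕ → ℕ} (hn : Tendsto n atTop atTop)
    {a : ℝ} (ha : a < 1)
    (h : (fun k => (d k : ℝ)) =O[atTop] fun k => Real.log (n k) ^ a) :
    IsSublogarithmic n d := by
  have hlog : Tendsto (fun k => Real.log (n k)) atTop atTop :=
    Real.tendsto_log_atTop.comp (tendsto_natCast_atTop_atTop.comp hn)
  have h1 : (fun x : ℝ => x ^ a) =o[atTop] fun x : ℝ => x := by
    refine isLittleO_of_tendsto' ?_ ?_
    · filter_upwards [eventually_gt_atTop 0] with x hx h0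
      exact absurd h0 hx.ne'
    · refine (tendsto_rpow_neg_atTop (sub_pos.mpr ha)).congr' ?_
      filter_upwards [eventually_gt_atTop 0] with x hx
      rw [neg_sub, Real.rpow_sub_one hx.ne']
  exact h.trans_isLittleO (h1.comp_tendsto hlog)

end RandomCircuit

/-!
The proof bounds the mean of `√(2 ^ n p)`, where `p` is the probability of the output `00…0`, and
concludes by Markov's inequality. The square root is what makes fluctuations of `p` around the
uniform value `2 ^ (-n)` visible: it is concave, so that they push its mean down.

* *Passing to a subset.* The Haar measure is invariant under bit flips after the last layer, so
  all output strings have the same law. Concavity then replaces `2 ^ n p` by `2 ^ |S|` times the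
  marginal probability that all qubits of a set `S` give `0`
  (`sqrt_two_pow_mul_integral_sqrt_zeroProb_le`).
* *Independence.* Backward light cones have at most `2 ^ d` qubits, so there is a set `S` of at
  least `n / 4 ^ d` qubits with pairwise disjoint light cones (`exists_disjoint_cones`). In the
  Heisenberg picture the projection onto `0` of a qubit stays supported on its light cone and only
  involves the gates there. Hence the marginal probability is the product over `i ∈ S` of
  independent single-qubit probabilities `q_i = (1 + z_i) / 2`, where `z_i` is the expectation of
  the Pauli operator `Z` (`integral_sqrt_marginal`).
* *Single-qubit fluctuations.* The law of `z_i` is symmetric by a bit flip, so the mean of `√(2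
  q_i)` is at most `1 - E[z_i²] / 8`. A Haar random gate distributes a nontrivial Pauli operator
  on its pair, as far as second moments are concerned, uniformly over the fifteen nontrivial Pauli
  operators (`fifteen_mul_secondMoment`): these are all conjugate, and the sum of the squares of
  their expectations is a unitary invariant. Keeping only the two single-qubit `Z` operators gives
  `E[z_i²] ≥ (2 / 15) ^ d` (`secondMoment_Z_ge`).

Together the mean of `√(2 ^ n p)` is at most `exp (-(n / 4 ^ d) (2 / 15) ^ d / 8)`, that is `exp
(-n / (8 * 30 ^ d))` (`integral_sqrt_zeroProb_le`), and Markov's inequality loses only half of the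
exponent. For sublogarithmic depth `n / 30 ^ d` tends to infinity.
-/

namespace RandomCircuit

/-! ### Tensor products of two-qubit operators -/

/-- Operators on the space of `n` qubits, in the computational basis. -/
abbrev Op (n : ℕ) : Type := Matrix (Fin n → Fin 2) (Fin n → Fin 2) ℂ

/-- Operators on the space of two qubits, in the computational basis. -/
abbrev PairOp : Type := Matrix (Fin 2 × Fin 2) (Fin 2 × Fin 2) ℂ

/-- The operator acting as the `2 × 2` matrix `a` on qubit `j` and trivially on all others. -/
def siteOp {n : ℕ} (j : Fin n) (a : Matrix (Fin 2) (Fin 2) ℂ) : Op n :=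
  Matrix.of fun x y => if ∀ k, k ≠ j → x k = y k then a (x j) (y j) else 0

namespace ParallelArchitecture

variable {n d : ℕ} (A : ParallelArchitecture n d)

/-- The pair of layer `m` containing the qubit `q`. -/
def pairOf (m : Fin d) (q : Fin n) : A.LayerGate m :=
  if h : q < A.partner m q then ⟨q, h⟩ else
    ⟨A.partner m q, by
      rw [A.partner_partner]
      exact lt_of_le_of_ne (not_lt.mp h) (A.partner_ne m q)⟩

variable {A} in
lemma pairOf_of_lt {m : Fin d} {q : Fin n} (h : q < A.partner m q) :
    A.pairOf m q = ⟨q, h⟩ := dif_pos h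

variable {A} in
lemma pairOf_partner {m : Fin d} (q : A.LayerGate m) :
    A.pairOf m (A.partner m q) = q := by
  have h : ¬ A.partner m q < A.partner m (A.partner m q) := by
    rw [A.partner_partner]
    exact not_lt.mpr q.2.le
  rw [pairOf, dif_neg h]
  exact Subtype.ext (A.partner_partner m q)

lemma pairOf_cases (m : Fin d) (q : Fin n) :
    q = A.pairOf m q ∨ q = A.partner m (A.pairOf m q) := by
  unfold pairOf
  split_ifs with h
  · exact Or.inl rfl
  · exact Or.inr (A.partner_partner m q).symm

/-- Reading a bit string pair by pair. -/
def pairEquiv (m : Fin d) : (Fin n → Fin 2) ≃ (A.LayerGate m → Fin 2 × Fin 2) where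
  toFun x e := (x e, x (A.partner m e))
  invFun c q := if q < A.partner m q then (c (A.pairOf m q)).1 else (c (A.pairOf m q)).2
  left_inv x := by
    funext q
    by_cases h : q < A.partner m q
    · simp [pairOf, h]
    · simp [pairOf, h, A.partner_partner]
  right_inv c := by
    funext e
    have h : ¬ A.partner m e < A.partner m (A.partner m e) := by
      rw [A.partner_partner]
      exact not_lt.mpr e.2.le
    refine Prod.ext ?_ ?_
    · simp [e.2, pairOf_of_lt e.2]
    · simp only [h, if_false, pairOf_partner]

/-- The tensor product of two-qubit operators, one for each pair of layer `m`. -/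
def pairTensor (m : Fin d) : (A.LayerGate m → PairOp) →* Op n where
  toFun w := Matrix.of fun x y => ∏ e, w e (A.pairEquiv m x e) (A.pairEquiv m y e)
  map_one' := by
    ext x y
    simp only [Matrix.of_apply, Pi.one_apply, Matrix.one_apply, Finset.prod_ite_zero,
      Finset.prod_const_one, Finset.mem_univ, true_implies]
    congr 1
    rw [← funext_iff, (A.pairEquiv m).apply_eq_iff_eq]
  map_mul' w v := by
    ext x y
    simp only [Matrix.of_apply, Pi.mul_apply, Matrix.mul_apply, ← Finset.prod_mul_distrib]
    rw [Finset.prod_univ_sum, Fintype.piFinset_univ]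
    exact ((A.pairEquiv m).sum_comp fun c : A.LayerGate m → Fin 2 × Fin 2 =>
      ∏ e, w e (A.pairEquiv m x e) (c e) * v e (c e) (A.pairEquiv m y e)).symm

lemma pairTensor_apply (m : Fin d) (w : A.LayerGate m → PairOp) (x y : Fin n → Fin 2) :
    A.pairTensor m w x y = ∏ e, w e (A.pairEquiv m x e) (A.pairEquiv m y e) := rfl

lemma layer_eq_pairTensor (g : A.Gate → TwoQubitGate) (m : Fin d) :
    A.layer g m = A.pairTensor m fun e => (g ⟨m, e⟩ : PairOp) := rfl

lemma star_pairTensor (m : Fin d) (w : A.LayerGate m → PairOp) :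
    star (A.pairTensor m w) = A.pairTensor m (star w) := by
  ext x y
  simp [Matrix.star_apply, pairTensor_apply]

/-- The operator acting as a two-qubit operator on one pair of layer `m`, and trivially on the
other pairs. -/
def gateOp (m : Fin d) (e : A.LayerGate m) : PairOp →ₐ[ℂ] Op n :=
  AlgHom.ofLinearMap
    { toFun := fun M => A.pairTensor m (Pi.mulSingle e M)
      map_add' := fun M N => by
        ext x y
        simp only [Matrix.add_apply, pairTensor_apply]
        rw [Fintype.prod_eq_mul_prod_compl e, Fintype.prod_eq_mul_prod_compl e,
          Fintype.prod_eq_mul_prod_compl e]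
        simp only [Pi.mulSingle_eq_same, Matrix.add_apply, add_mul]
        congr 2 <;> refine Finset.prod_congr rfl fun f hf => ?_ <;>
          · have : f ≠ e := by simpa using hf
            simp [Pi.mulSingle_eq_of_ne this]
      map_smul' := fun c M => by
        ext x y
        simp only [Matrix.smul_apply, pairTensor_apply, RingHom.id_apply]
        rw [Fintype.prod_eq_mul_prod_compl e, Fintype.prod_eq_mul_prod_compl e]
        simp only [Pi.mulSingle_eq_same, Matrix.smul_apply, smul_mul_assoc]
        congr 2
        refine Finset.prod_congr rfl fun f hf => ?_
        have : f ≠ e := by simpa using hf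
        simp [Pi.mulSingle_eq_of_ne this] }
    (by simp) (fun M N => by simp [Pi.mulSingle_mul])

lemma gateOp_apply (m : Fin d) (e : A.LayerGate m) (M : PairOp) :
    A.gateOp m e M = A.pairTensor m (Pi.mulSingle e M) := rfl

lemma gateOp_entry (m : Fin d) (e : A.LayerGate m) (M : PairOp) (x y : Fin n → Fin 2) :
    A.gateOp m e M x y = if ∀ f, f ≠ e → A.pairEquiv m x f = A.pairEquiv m y f then
      M (A.pairEquiv m x e) (A.pairEquiv m y e) else 0 := by
  rw [gateOp_apply, pairTensor_apply, Fintype.prod_eq_mul_prod_compl e, Pi.mulSingle_eq_same]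
  have : ∏ f ∈ {e}ᶜ, (Pi.mulSingle e M : A.LayerGate m → PairOp) f (A.pairEquiv m x f)
      (A.pairEquiv m y f) = ∏ f ∈ {e}ᶜ,
        if A.pairEquiv m x f = A.pairEquiv m y f then (1 : ℂ) else 0 := by
    refine Finset.prod_congr rfl fun f hf => ?_
    have : f ≠ e := by simpa using hf
    rw [Pi.mulSingle_eq_of_ne this, Matrix.one_apply]
  rw [this, Finset.prod_ite_zero]
  simp

open Kronecker in
/-- A single-qubit operator acts on the pair containing the qubit, whatever the layer. -/
lemma gateOp_kronecker_one (m : Fin d) (e : A.LayerGate m) (a : Matrix (Fin 2) (Fin 2) ℂ) :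
    A.gateOp m e (a ⊗ₖ 1) = siteOp (e : Fin n) a := by
  ext x y
  rw [gateOp_entry, siteOp, Matrix.of_apply]
  simp only [Matrix.kroneckerMap_apply, pairEquiv, Equiv.coe_fn_mk, Matrix.one_apply, mul_ite,
    mul_one, mul_zero, Prod.mk.injEq]
  rw [← ite_and]
  congr 1
  refine propext ⟨fun ⟨h, h'⟩ k hk => ?_, fun h => ⟨fun f hf => ⟨h _ ?_, h _ ?_⟩, h _ ?_⟩⟩
  · by_cases hke : A.pairOf m k = e
    · rcases A.pairOf_cases m k with h1 | h1
      · exact absurd (h1.trans (congrArg _ hke)) hk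
      · rw [h1, hke]; exact h'
    · rcases A.pairOf_cases m k with h1 | h1 <;> rw [h1]
      · exact (h _ hke).1
      · exact (h _ hke).2
  · exact fun hh => hf (Subtype.ext hh)
  · intro hh
    have := A.pairOf_partner f
    rw [hh, pairOf_of_lt e.2] at this
    exact hf this.symm
  · exact e.2.ne'

open Kronecker in
lemma gateOp_one_kronecker (m : Fin d) (e : A.LayerGate m) (a : Matrix (Fin 2) (Fin 2) ℂ) :
    A.gateOp m e (1 ⊗ₖ a) = siteOp (A.partner m e) a := by
  ext x y
  rw [gateOp_entry, siteOp, Matrix.of_apply]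
  simp only [Matrix.kroneckerMap_apply, pairEquiv, Equiv.coe_fn_mk, Matrix.one_apply, ite_mul,
    one_mul, zero_mul, Prod.mk.injEq]
  rw [← ite_and]
  congr 1
  refine propext ⟨fun ⟨h, h'⟩ k hk => ?_, fun h => ⟨fun f hf => ⟨h _ ?_, h _ ?_⟩, h _ ?_⟩⟩
  · by_cases hke : A.pairOf m k = e
    · rcases A.pairOf_cases m k with h1 | h1
      · rw [h1, hke]; exact h'
      · exact absurd (h1.trans (congrArg (fun f : A.LayerGate m => A.partner m f) hke)) hk
    · rcases A.pairOf_cases m k with h1 | h1 <;> rw [h1]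
      · exact (h _ hke).1
      · exact (h _ hke).2
  · intro hh
    have := A.pairOf_partner e
    rw [← hh, pairOf_of_lt f.2] at this
    exact hf this
  · intro hh
    have := congrArg (A.pairOf m) hh
    rw [pairOf_partner, pairOf_partner] at this
    exact hf this
  · exact e.2.ne

end ParallelArchitecture

/-! ### Supports of operators -/

/-- The operator acts trivially outside the set `T` of qubits; encoded as commutation with all
single-qubit operators outside `T`. -/
def IsSupportedOn {n : ℕ} (T : Finset (Fin n)) (O : Op n) : Prop :=
  ∀ j ∉ T, ∀ a, Commute O (siteOp j a)

/-- A supported operator maps `|0…0⟩` to a combination of bit strings vanishing outside the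
support. -/
lemma IsSupportedOn.apply_zero_left {n : ℕ} {T : Finset (Fin n)} {O : Op n}
    (h : IsSupportedOn T O) {j : Fin n} (hj : j ∉ T) {y : Fin n → Fin 2} (hy : y j ≠ 0) :
    O 0 y = 0 := by
  have hE : (siteOp j (Matrix.single 0 0 1) : Op n) =
      Matrix.diagonal fun x => if x j = 0 then 1 else 0 := by
    ext x y
    simp only [siteOp, Matrix.of_apply, Matrix.diagonal_apply, Matrix.single_apply]
    by_cases hxy : x = y
    · subst hxy; simp [eq_comm]
    · rw [if_neg hxy]
      split_ifs with h1 h2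
      · refine absurd (funext fun k => ?_) hxy
        by_cases hk : k = j
        · subst hk; rw [← h2.1, ← h2.2]
        · exact h1 k hk
      · rfl
      · rfl
  have h1 := congrFun (congrFun (h j hj (Matrix.single 0 0 1)).eq 0) y
  rw [hE, Matrix.mul_diagonal, Matrix.diagonal_mul] at h1
  simpa [hy] using h1.symm

lemma IsSupportedOn.star {n : ℕ} {T : Finset (Fin n)} {O : Op n}
    (h : IsSupportedOn T O) : IsSupportedOn T (star O) := by
  intro j hj a
  have h1 := (h j hj (Star.star a)).star_star
  convert h1 using 1
  ext x y
  simp only [siteOp, Matrix.of_apply, Matrix.star_apply]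
  by_cases hc : ∀ k, k ≠ j → x k = y k
  · rw [if_pos hc, if_pos fun k hk => (hc k hk).symm, star_star]
  · rw [if_neg hc, if_neg fun h => hc fun k hk => (h k hk).symm, star_zero]

/-- The expectation in the product state `|0…0⟩` is multiplicative on operators with disjoint
supports. -/
lemma IsSupportedOn.mul_apply_zero {n : ℕ} {T T' : Finset (Fin n)} {O O' : Op n}
    (h : IsSupportedOn T O) (h' : IsSupportedOn T' O') (hT : Disjoint T T') :
    (O * O') 0 0 = O 0 0 * O' 0 0 := by
  rw [Matrix.mul_apply]
  refine Finset.sum_eq_single_of_mem 0 (Finset.mem_univ _) fun y _ hy => ?_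
  obtain ⟨j, hj⟩ := Function.ne_iff.mp hy
  by_cases hjT : j ∈ T
  · have := h'.star.apply_zero_left (Finset.disjoint_left.mp hT hjT) hj
    rw [Matrix.star_apply, star_eq_zero] at this
    rw [this, mul_zero]
  · rw [h.apply_zero_left hjT hj, zero_mul]

/-- A diagonal operator whose entries depend only on the bits in `T` is supported on `T`. -/
lemma isSupportedOn_diagonal {n : ℕ} {T : Finset (Fin n)} (f : (Fin n → Fin 2) → ℂ)
    (hf : DependsOn f T) : IsSupportedOn T (Matrix.diagonal f) := by
  intro j hj a
  ext x y
  rw [Matrix.diagonal_mul, Matrix.mul_diagonal]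
  simp only [siteOp, Matrix.of_apply]
  split_ifs with h
  · rw [hf (fun k hk => h k fun hkj => hj (hkj ▸ hk)), mul_comm]
  · simp

namespace ParallelArchitecture

variable {n d : ℕ} (A : ParallelArchitecture n d)

open Kronecker in
lemma commute_gateOp {T : Finset (Fin n)} {O : Op n} (h : IsSupportedOn T O)
    {m : Fin d} {e : A.LayerGate m} (h1 : (e : Fin n) ∉ T) (h2 : A.partner m e ∉ T) (M : PairOp) :
    Commute O (A.gateOp m e M) := by
  induction M using Matrix.induction_on' with
  | h_zero => simp
  | h_add M N hM hN => rw [map_add]; exact hM.add_right hN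
  | h_std_basis i j c =>
    have : Matrix.single i j c = (Matrix.single i.1 j.1 c ⊗ₖ 1 : PairOp) *
        (1 ⊗ₖ Matrix.single i.2 j.2 1 : PairOp) := by
      rw [← Matrix.mul_kronecker_mul, mul_one, one_mul, Matrix.single_kronecker_single, mul_one]
    rw [this, map_mul, gateOp_kronecker_one, gateOp_one_kronecker]
    exact (h _ h1 _).mul_right (h _ h2 _)

lemma commute_pairTensor {T : Finset (Fin n)} {O : Op n} (h : IsSupportedOn T O)
    {m : Fin d} {w : A.LayerGate m → PairOp}
    (hw : ∀ e : A.LayerGate m, (e : Fin n) ∈ T ∨ A.partner m e ∈ T → w e = 1) :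
    Commute O (A.pairTensor m w) := by
  have : w ∈ (Submonoid.centralizer {O}).comap (A.pairTensor m) := by
    refine Submonoid.pi_mem_of_mulSingle_mem _ fun e => ?_
    rw [Submonoid.mem_comap, Submonoid.mem_centralizer_iff]
    rintro _ rfl
    by_cases he : (e : Fin n) ∈ T ∨ A.partner m e ∈ T
    · rw [hw e he]; simp
    · rw [not_or] at he
      exact (A.commute_gateOp h he.1 he.2 (w e)).eq
  exact Submonoid.mem_centralizer_iff.mp this O rfl

lemma star_layer_mul_layer (g : A.Gate → TwoQubitGate) (m : Fin d) :
    star (A.layer g m) * A.layer g m = 1 := by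
  rw [layer_eq_pairTensor, star_pairTensor, ← map_mul, ← map_one (A.pairTensor m)]
  congr 1
  funext e
  exact Unitary.coe_star_mul_self (g ⟨m, e⟩)

lemma layer_mul_star_layer (g : A.Gate → TwoQubitGate) (m : Fin d) :
    A.layer g m * star (A.layer g m) = 1 :=
  mul_eq_one_comm.mp (A.star_layer_mul_layer g m)

/-- Conjugation by a layer turns an operator on one pair into an operator on the same pair. -/
lemma star_layer_mul_gateOp_mul_layer (g : A.Gate → TwoQubitGate) (m : Fin d)
    (e : A.LayerGate m) (M : PairOp) :
    star (A.layer g m) * A.gateOp m e M * A.layer g m =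
      A.gateOp m e (star (g ⟨m, e⟩ : PairOp) * M * (g ⟨m, e⟩ : PairOp)) := by
  rw [layer_eq_pairTensor, star_pairTensor, gateOp_apply, gateOp_apply, ← map_mul, ← map_mul]
  congr 1
  funext f
  by_cases hf : f = e
  · subst hf; simp
  · simp only [Pi.mul_apply, Pi.star_apply, Pi.mulSingle_eq_of_ne hf, mul_one]
    exact Unitary.coe_star_mul_self (g ⟨m, f⟩)

/-- The qubits that share a pair of layer `m` with a qubit of `T`. -/
def enlarge (m : Fin d) (T : Finset (Fin n)) : Finset (Fin n) := T ∪ T.image (A.partner m)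

lemma subset_enlarge (m : Fin d) (T : Finset (Fin n)) : T ⊆ A.enlarge m T :=
  Finset.subset_union_left

lemma partner_mem_enlarge {m : Fin d} {T : Finset (Fin n)} {i : Fin n} (hi : i ∈ T) :
    A.partner m i ∈ A.enlarge m T :=
  Finset.mem_union_right _ (Finset.mem_image_of_mem _ hi)

/-- The Heisenberg evolution through a layer enlarges the support at most by the partners. -/
lemma isSupportedOn_conj_layer {T : Finset (Fin n)} {O : Op n} (h : IsSupportedOn T O)
    (g : A.Gate → TwoQubitGate) (m : Fin d) :
    IsSupportedOn (A.enlarge m T) (star (A.layer g m) * O * A.layer g m) := by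
  intro j hj a
  set L := A.layer g m
  have hL : star L * L = 1 := A.star_layer_mul_layer g m
  have hL' : L * star L = 1 := A.layer_mul_star_layer g m
  -- commutation with `siteOp j a` is moved through `L`, which keeps it on the pair of `j`
  have key : Commute O (L * siteOp j a * star L) := by
    have hE : ∃ M, L * siteOp j a * star L = A.gateOp m (A.pairOf m j) M := by
      have h0 : ∃ M, (siteOp j a : Op n) = A.gateOp m (A.pairOf m j) M := by
        rcases A.pairOf_cases m j with h1 | h1
        · refine ⟨_, ((A.gateOp_kronecker_one m _ a).trans ?_).symm⟩
          rw [← h1]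
        · refine ⟨_, ((A.gateOp_one_kronecker m _ a).trans ?_).symm⟩
          rw [← h1]
      obtain ⟨M, hM⟩ := h0
      refine ⟨(g ⟨m, A.pairOf m j⟩ : PairOp) * M * star (g ⟨m, A.pairOf m j⟩ : PairOp), ?_⟩
      have h2 := A.star_layer_mul_gateOp_mul_layer g m (A.pairOf m j)
        ((g ⟨m, A.pairOf m j⟩ : PairOp) * M * star (g ⟨m, A.pairOf m j⟩ : PairOp))
      have h3 : star (g ⟨m, A.pairOf m j⟩ : PairOp) * (g ⟨m, A.pairOf m j⟩ : PairOp) = 1 :=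
        Unitary.coe_star_mul_self _
      have h4 : star (g ⟨m, A.pairOf m j⟩ : PairOp) * ((g ⟨m, A.pairOf m j⟩ : PairOp) * M *
          star (g ⟨m, A.pairOf m j⟩ : PairOp)) * (g ⟨m, A.pairOf m j⟩ : PairOp) = M := by
        simp only [mul_assoc, h3, mul_one]
        rw [← mul_assoc, h3, one_mul]
      rw [h4, ← hM] at h2
      rw [← h2]
      change L * (star L * _ * L) * star L = _
      simp only [mul_assoc, hL', mul_one]
      rw [← mul_assoc, hL', one_mul]
    obtain ⟨M, hM⟩ := hE
    rw [hM]
    refine A.commute_gateOp h (fun hT => hj ?_) (fun hT => hj ?_) M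
    · rcases A.pairOf_cases m j with h1 | h1 <;> rw [h1]
      · exact A.subset_enlarge m T hT
      · exact A.partner_mem_enlarge hT
    · rcases A.pairOf_cases m j with h1 | h1 <;> rw [h1]
      · rw [← A.partner_partner m (A.pairOf m j)]
        exact A.partner_mem_enlarge hT
      · exact A.subset_enlarge m T hT
  calc star L * O * L * siteOp j a = star L * (O * (L * siteOp j a * star L)) * L := by
        simp only [mul_assoc, hL, mul_one]
    _ = star L * ((L * siteOp j a * star L) * O) * L := by rw [key.eq]
    _ = siteOp j a * (star L * O * L) := by
        simp only [mul_assoc]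
        rw [← mul_assoc (star L) L, hL, one_mul]

/-- The Heisenberg evolution through a layer only involves the gates that meet the support. -/
lemma conj_layer_congr {T : Finset (Fin n)} {O : Op n} (h : IsSupportedOn T O)
    {g g' : A.Gate → TwoQubitGate} {m : Fin d}
    (hg : ∀ e : A.LayerGate m, (e : Fin n) ∈ A.enlarge m T → g ⟨m, e⟩ = g' ⟨m, e⟩) :
    star (A.layer g m) * O * A.layer g m = star (A.layer g' m) * O * A.layer g' m := by
  -- `W` acts trivially on the pairs meeting `T`, hence commutes with `O`
  set W := A.layer g m * star (A.layer g' m) with hW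
  have hcomm : Commute O W := by
    rw [hW, layer_eq_pairTensor, layer_eq_pairTensor, star_pairTensor, ← map_mul]
    refine A.commute_pairTensor h fun e he => ?_
    have : (e : Fin n) ∈ A.enlarge m T := by
      rcases he with he | he
      · exact A.subset_enlarge m T he
      · rw [← A.partner_partner m e]; exact A.partner_mem_enlarge he
    simp only [Pi.mul_apply, Pi.star_apply, hg e this]
    exact Unitary.coe_mul_star_self _
  have h1 : A.layer g m = W * A.layer g' m := by
    rw [hW, mul_assoc, star_layer_mul_layer, mul_one]
  have h2 : star W * W = 1 := by
    rw [hW, star_mul, star_star, mul_assoc, ← mul_assoc (star (A.layer g m)),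
      star_layer_mul_layer, one_mul, layer_mul_star_layer]
  rw [h1, star_mul]
  calc star (A.layer g' m) * star W * O * (W * A.layer g' m)
      = star (A.layer g' m) * (star W * (O * W)) * A.layer g' m := by simp only [mul_assoc]
    _ = star (A.layer g' m) * O * A.layer g' m := by
        rw [hcomm.eq, ← mul_assoc (star W), h2, one_mul]

/-! ### Heisenberg evolution and light cones -/

/-- The product of the first `m` layers. -/
noncomputable def prefixCircuit (g : A.Gate → TwoQubitGate) : (m : ℕ) → m ≤ d → Op n
  | 0, _ => 1
  | m + 1, h => A.layer g ⟨m, h⟩ * prefixCircuit g m (Nat.le_of_succ_le h)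

lemma prefixCircuit_eq_prod (g : A.Gate → TwoQubitGate) (m : ℕ) (h : m ≤ d) :
    A.prefixCircuit g m h =
      (List.ofFn fun i : Fin m => A.layer g (Fin.castLE h i)).reverse.prod := by
  induction m with
  | zero => simp [prefixCircuit]
  | succ m ih =>
    rw [prefixCircuit, ih, List.ofFn_succ', List.concat_eq_append, List.reverse_append,
      List.prod_append]
    simp
    rfl

lemma prefixCircuit_eq_circuit (g : A.Gate → TwoQubitGate) :
    A.prefixCircuit g d le_rfl = A.circuit g :=
  A.prefixCircuit_eq_prod g d le_rfl

lemma star_prefixCircuit_mul_self (g : A.Gate → TwoQubitGate) (m : ℕ) (h : m ≤ d) :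
    star (A.prefixCircuit g m h) * A.prefixCircuit g m h = 1 := by
  induction m with
  | zero => simp [prefixCircuit]
  | succ m ih =>
    rw [prefixCircuit, star_mul, mul_assoc, ← mul_assoc (star (A.layer g _)),
      star_layer_mul_layer, one_mul, ih]

/-- The Heisenberg evolution of an operator through the first `m` layers. -/
noncomputable def evolve (g : A.Gate → TwoQubitGate) (m : ℕ) (h : m ≤ d) (O : Op n) : Op n :=
  star (A.prefixCircuit g m h) * O * A.prefixCircuit g m h

lemma evolve_succ (g : A.Gate → TwoQubitGate) (m : ℕ) (h : m + 1 ≤ d) (O : Op n) :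
    A.evolve g (m + 1) h O = A.evolve g m (Nat.le_of_succ_le h)
      (star (A.layer g ⟨m, h⟩) * O * A.layer g ⟨m, h⟩) := by
  simp only [evolve, prefixCircuit, star_mul, mul_assoc]

lemma evolve_one (g : A.Gate → TwoQubitGate) (m : ℕ) (h : m ≤ d) : A.evolve g m h 1 = 1 := by
  rw [evolve, mul_one, star_prefixCircuit_mul_self]

lemma evolve_mul (g : A.Gate → TwoQubitGate) (m : ℕ) (h : m ≤ d) (O O' : Op n) :
    A.evolve g m h (O * O') = A.evolve g m h O * A.evolve g m h O' := by
  have hU := mul_eq_one_comm.mp (A.star_prefixCircuit_mul_self g m h)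
  simp only [evolve, mul_assoc]
  rw [← mul_assoc (A.prefixCircuit g m h) (star _), hU, one_mul]

/-- The backward light cone, in the first `m` layers, of a set of qubits at the end of these
layers: the qubits at the beginning of the circuit that can influence it. -/
def cone : (m : ℕ) → m ≤ d → Finset (Fin n) → Finset (Fin n)
  | 0, _, T => T
  | m + 1, h, T => cone m (Nat.le_of_succ_le h) (A.enlarge ⟨m, h⟩ T)

lemma subset_cone (m : ℕ) (h : m ≤ d) (T : Finset (Fin n)) : T ⊆ A.cone m h T := by
  induction m generalizing T with
  | zero => exact subset_rfl
  | succ m ih => exact (A.subset_enlarge _ T).trans (ih _ _)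

lemma isSupportedOn_evolve {T : Finset (Fin n)} {O : Op n} (hO : IsSupportedOn T O)
    (g : A.Gate → TwoQubitGate) (m : ℕ) (h : m ≤ d) :
    IsSupportedOn (A.cone m h T) (A.evolve g m h O) := by
  induction m generalizing T O with
  | zero => simpa [cone, evolve, prefixCircuit] using hO
  | succ m ih =>
    rw [evolve_succ]
    exact ih (A.isSupportedOn_conj_layer hO g _) _

/-- Only the gates inside the light cone influence the evolution of an operator. -/
lemma evolve_congr {T : Finset (Fin n)} {O : Op n} (hO : IsSupportedOn T O)
    {g g' : A.Gate → TwoQubitGate} (m : ℕ) (h : m ≤ d)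
    (hg : ∀ e : A.Gate, (e.2 : Fin n) ∈ A.cone m h T → g e = g' e) :
    A.evolve g m h O = A.evolve g' m h O := by
  induction m generalizing T O with
  | zero => simp [evolve, prefixCircuit]
  | succ m ih =>
    rw [evolve_succ, evolve_succ, A.conj_layer_congr hO (g' := g')
      fun e he => hg ⟨_, e⟩
        (A.subset_cone m (Nat.le_of_succ_le h) (A.enlarge ⟨m, h⟩ T) he)]
    exact ih (A.isSupportedOn_conj_layer hO g' _) _ hg

lemma mem_cone_iff (m : ℕ) (h : m ≤ d) (T : Finset (Fin n)) (j : Fin n) :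
    j ∈ A.cone m h T ↔ ∃ i ∈ T, j ∈ A.cone m h {i} := by
  induction m generalizing T with
  | zero => simp [cone]
  | succ m ih =>
    simp only [cone]
    rw [ih]
    constructor
    · rintro ⟨i, hi, hj⟩
      rcases Finset.mem_union.mp hi with hi | hi
      · exact ⟨i, hi, (ih _ _).mpr ⟨i, A.subset_enlarge _ _ (Finset.mem_singleton_self i), hj⟩⟩
      · obtain ⟨k, hk, rfl⟩ := Finset.mem_image.mp hi
        exact ⟨k, hk, (ih _ _).mpr
          ⟨_, A.partner_mem_enlarge (Finset.mem_singleton_self k), hj⟩⟩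
    · rintro ⟨i, hi, hj⟩
      obtain ⟨k, hk, hj⟩ := (ih _ _).mp hj
      exact ⟨k, Finset.union_subset_union (Finset.singleton_subset_iff.mpr hi)
        (Finset.image_subset_image (Finset.singleton_subset_iff.mpr hi)) hk, hj⟩

lemma card_cone_le (m : ℕ) (h : m ≤ d) (T : Finset (Fin n)) :
    (A.cone m h T).card ≤ 2 ^ m * T.card := by
  induction m generalizing T with
  | zero => simp [cone]
  | succ m ih =>
    refine (ih _ _).trans ?_
    have : (A.enlarge ⟨m, h⟩ T).card ≤ T.card + T.card :=
      (Finset.card_union_le _ _).trans (Nat.add_le_add_left Finset.card_image_le _)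
    rw [pow_succ, mul_assoc]
    exact Nat.mul_le_mul_left _ (by omega)

lemma card_filter_mem_cone_le (m : ℕ) (h : m ≤ d) (j : Fin n) :
    (Finset.univ.filter fun i => j ∈ A.cone m h {i}).card ≤ 2 ^ m := by
  induction m with
  | zero =>
    simp only [cone, Finset.mem_singleton]
    rw [Finset.filter_eq]
    simp
  | succ m ih =>
    set B := Finset.univ.filter fun i => j ∈ A.cone m (Nat.le_of_succ_le h) {i}
    have hsub : (Finset.univ.filter fun i => j ∈ A.cone (m + 1) h {i}) ⊆
        B ∪ B.image (A.partner ⟨m, h⟩) := by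
      intro i hi
      obtain ⟨k, hk, hj⟩ := (A.mem_cone_iff m (Nat.le_of_succ_le h)
        (A.enlarge ⟨m, h⟩ {i}) j).mp (Finset.mem_filter.mp hi).2
      rcases Finset.mem_union.mp hk with hk | hk
      · rw [Finset.mem_singleton] at hk
        subst hk
        exact Finset.mem_union_left _ (by simpa [B] using hj)
      · rw [Finset.image_singleton, Finset.mem_singleton] at hk
        subst hk
        exact Finset.mem_union_right _ (Finset.mem_image.mpr
          ⟨_, by simpa [B] using hj, A.partner_partner _ i⟩)
    have h1 := (Finset.card_le_card hsub).trans (Finset.card_union_le _ _)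
    have h2 : (B.image (A.partner ⟨m, h⟩)).card ≤ B.card := Finset.card_image_le
    have h3 : B.card ≤ 2 ^ m := ih _
    rw [pow_succ]
    omega

/-- There is a set of at least `n / 4 ^ d` qubits with pairwise disjoint light cones. A maximal set
will do, since each light cone meets at most `4 ^ d` others. -/
lemma exists_disjoint_cones :
    ∃ S : Finset (Fin n), n ≤ S.card * 4 ^ d ∧
      (S : Set (Fin n)).PairwiseDisjoint fun i => A.cone d le_rfl {i} := by
  classical
  obtain ⟨S, hS, hmax⟩ := (Finset.univ.filter fun S : Finset (Fin n) =>
    (S : Set (Fin n)).PairwiseDisjoint fun i => A.cone d le_rfl {i}).exists_maximal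
    ⟨∅, by simp⟩
  simp only [Finset.mem_filter, Finset.mem_univ, true_and] at hS hmax
  refine ⟨S, ?_, hS⟩
  have hcov : (Finset.univ : Finset (Fin n)) ⊆ S.biUnion fun s => (A.cone d le_rfl {s}).biUnion
      fun j => Finset.univ.filter fun i => j ∈ A.cone d le_rfl {i} := by
    intro i _
    simp only [Finset.mem_biUnion, Finset.mem_filter, Finset.mem_univ, true_and]
    by_contra! hcon
    have hins : ((insert i S : Finset (Fin n)) : Set (Fin n)).PairwiseDisjoint
        fun i => A.cone d le_rfl {i} := by
      rw [Finset.coe_insert]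
      exact hS.insert fun s hs _ =>
        Finset.disjoint_left.mpr fun j hj hj' => hcon s hs j hj' hj
    have hiS : i ∈ S := hmax hins (Finset.subset_insert i S) (Finset.mem_insert_self i S)
    exact hcon i hiS i (A.subset_cone _ _ _ (Finset.mem_singleton_self i))
      (A.subset_cone _ _ _ (Finset.mem_singleton_self i))
  have h1 := Finset.card_le_card hcov
  rw [Finset.card_univ, Fintype.card_fin] at h1
  refine h1.trans (Finset.card_biUnion_le_card_mul _ _ _ fun s _ => ?_)
  refine (Finset.card_biUnion_le_card_mul _ _ _ fun j _ =>
    A.card_filter_mem_cone_le d le_rfl j).trans ?_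
  have := A.card_cone_le d le_rfl {s}
  rw [Finset.card_singleton, mul_one] at this
  calc _ ≤ 2 ^ d * 2 ^ d := Nat.mul_le_mul_right _ this
    _ = 4 ^ d := by rw [← mul_pow]; norm_num

end ParallelArchitecture

/-! ### Pauli matrices -/

open Kronecker

/-- The Pauli matrices `1, X, Y, Z`. -/
noncomputable def pauli : Fin 4 → Matrix (Fin 2) (Fin 2) ℂ :=
  ![1, !![0, 1; 1, 0], !![0, -Complex.I; Complex.I, 0], !![1, 0; 0, -1]]

/-- The Pauli matrices on two qubits. -/
noncomputable def pauliPair (p : Fin 4 × Fin 4) : PairOp := pauli p.1 ⊗ₖ pauli p.2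

lemma pauli_zero : pauli 0 = 1 := rfl

lemma star_pauli (a : Fin 4) : star (pauli a) = pauli a := by
  ext i j
  fin_cases a <;> fin_cases i <;> fin_cases j <;> simp [pauli, Matrix.star_apply]

lemma pauli_mul_self (a : Fin 4) : pauli a * pauli a = 1 := by
  ext i j
  fin_cases a <;> fin_cases i <;> fin_cases j <;> simp [pauli]

/-- The sign picked up by two Pauli matrices when they are interchanged. -/
def pauliSign (a b : Fin 4) : ℤ := if a = 0 ∨ b = 0 ∨ a = b then 1 else -1

lemma pauli_mul_pauli (a b : Fin 4) :
    pauli a * pauli b = pauliSign a b • (pauli b * pauli a) := by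
  ext i j
  fin_cases a <;> fin_cases b <;> fin_cases i <;> fin_cases j <;> simp [pauli, pauliSign]

lemma pauliPair_zero : pauliPair 0 = 1 := by
  simp [pauliPair, pauli_zero]

lemma star_pauliPair (p : Fin 4 × Fin 4) : star (pauliPair p) = pauliPair p := by
  rw [pauliPair, Matrix.star_eq_conjTranspose, Matrix.conjTranspose_kronecker,
    ← Matrix.star_eq_conjTranspose, ← Matrix.star_eq_conjTranspose, star_pauli, star_pauli]

lemma pauliPair_mul_self (p : Fin 4 × Fin 4) : pauliPair p * pauliPair p = 1 := by
  rw [pauliPair, ← Matrix.mul_kronecker_mul, pauli_mul_self, pauli_mul_self,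
    Matrix.one_kronecker_one]

lemma pauliPair_anticomm {p q : Fin 4 × Fin 4}
    (h : pauliSign p.1 q.1 * pauliSign p.2 q.2 = -1) :
    pauliPair p * pauliPair q = -(pauliPair q * pauliPair p) := by
  rw [pauliPair, pauliPair, ← Matrix.mul_kronecker_mul, ← Matrix.mul_kronecker_mul,
    pauli_mul_pauli, pauli_mul_pauli p.2, Matrix.smul_kronecker, Matrix.kronecker_smul, smul_smul,
    h, neg_one_smul]

/-- Two nontrivial Pauli matrices anticommute with a common third one. -/
lemma exists_pauliSign (p q : Fin 4 × Fin 4) (hp : p ≠ 0) (hq : q ≠ 0) :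
    ∃ r : Fin 4 × Fin 4, pauliSign p.1 r.1 * pauliSign p.2 r.2 = -1 ∧
      pauliSign r.1 q.1 * pauliSign r.2 q.2 = -1 := by
  revert p q
  decide +kernel

/-- If `P` and `Q` are anticommuting Hermitian unitaries, the unitary `(P + Q) / √2` conjugates
one to the other. -/
lemma exists_unitary_conj {P Q : PairOp} (hP : star P = P) (hQ : star Q = Q) (hP2 : P * P = 1)
    (hQ2 : Q * Q = 1) (h : P * Q = -(Q * P)) :
    ∃ w : TwoQubitGate, star (w : PairOp) * P * (w : PairOp) = Q := by
  set c : ℂ := ((√2 : ℝ) : ℂ)⁻¹ with hc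
  have hcc : c * c = 1 / 2 := by
    rw [hc, ← mul_inv, ← Complex.ofReal_mul, Real.mul_self_sqrt (by norm_num)]
    norm_num
  have hcs : star c = c := by
    rw [hc, star_inv₀]
    exact congrArg _ (Complex.conj_ofReal _)
  have hw : star (c • (P + Q)) = c • (P + Q) := by
    rw [star_smul, star_add, hP, hQ, hcs]
  have hmul : (c • (P + Q)) * (c • (P + Q)) = 1 := by
    rw [smul_mul_smul_comm, hcc, add_mul, mul_add, mul_add, hP2, hQ2, h,
      show (1 : PairOp) + -(Q * P) + (Q * P + 1) = (2 : ℂ) • 1 by rw [two_smul]; abel, smul_smul]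
    norm_num
  refine ⟨⟨c • (P + Q), ?_⟩, ?_⟩
  · rw [Matrix.mem_unitaryGroup_iff, hw, hmul]
  · change star (c • (P + Q)) * P * (c • (P + Q)) = Q
    rw [hw, smul_mul_assoc, smul_mul_smul_comm, hcc, add_mul, hP2, mul_add, add_mul, add_mul,
      one_mul, one_mul, mul_assoc Q P P, hP2, mul_assoc Q P Q, h, mul_neg, ← mul_assoc Q Q P, hQ2,
      one_mul, mul_one,
      show P + Q + (Q + -P) = (2 : ℂ) • Q by rw [two_smul]; abel, smul_smul]
    norm_num

lemma sum_sq_trace_pauliPair_mul (ρ : PairOp) :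
    ∑ p, (pauliPair p * ρ).trace ^ 2 = 4 * (ρ * ρ).trace := by
  have hI := Complex.I_sq
  simp only [Fintype.sum_prod_type, Fin.sum_univ_four, Matrix.trace, Matrix.diag, Matrix.mul_apply,
    Fin.sum_univ_two, pauliPair, Matrix.kroneckerMap_apply]
  simp [pauli]
  ring_nf
  simp only [hI]
  ring

/-- The sum of the squared Pauli coefficients is invariant under unitary conjugation: up to a
constant it is the purity `tr ρ²` of the dual matrix of the functional. -/
lemma sum_sq_conj_pauliPair (φ : PairOp →ₗ[ℂ] ℂ) (V : TwoQubitGate) :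
    ∑ p, φ (star (V : PairOp) * pauliPair p * (V : PairOp)) ^ 2 = ∑ p, φ (pauliPair p) ^ 2 := by
  set ρ : PairOp := Matrix.of fun i j => φ (Matrix.single j i 1) with hρ
  have hφ : ∀ M, φ M = (M * ρ).trace := by
    intro M
    conv_lhs => rw [Matrix.matrix_eq_sum_single M]
    simp only [map_sum, Matrix.trace, Matrix.diag, Matrix.mul_apply, hρ, Matrix.of_apply]
    refine Finset.sum_congr rfl fun i _ => Finset.sum_congr rfl fun j _ => ?_
    rw [← smul_eq_mul, ← map_smul, Matrix.smul_single, smul_eq_mul, mul_one]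
  have hV : star (V : PairOp) * (V : PairOp) = 1 := Unitary.coe_star_mul_self V
  have hφV : ∀ M, φ (star (V : PairOp) * M * (V : PairOp)) =
      (M * ((V : PairOp) * ρ * star (V : PairOp))).trace := by
    intro M
    rw [hφ, mul_assoc, mul_assoc, Matrix.trace_mul_comm]
    simp only [mul_assoc]
  simp only [hφV, hφ, sum_sq_trace_pauliPair_mul]
  congr 1
  rw [mul_assoc, ← mul_assoc (star (V : PairOp)), ← mul_assoc (star (V : PairOp)), hV, one_mul,
    ← mul_assoc, Matrix.trace_mul_comm, ← mul_assoc, ← mul_assoc, hV, one_mul]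

namespace ParallelArchitecture

variable {n d : ℕ} (A : ParallelArchitecture n d)

/-! ### Second moments of Pauli expectations -/

instance : SecondCountableTopology TwoQubitGate := by
  have : SecondCountableTopology PairOp :=
    inferInstanceAs (SecondCountableTopology (Fin 2 × Fin 2 → Fin 2 × Fin 2 → ℂ))
  exact TopologicalSpace.Subtype.secondCountableTopology _

lemma continuous_layer (m : Fin d) : Continuous fun g => A.layer g m :=
  continuous_matrix fun x y => continuous_finsetProd Finset.univ fun e _ =>
    (continuous_subtype_val.comp (continuous_apply (⟨m, e⟩ : A.Gate))).matrix_elem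
      (x e, x (A.partner m e)) (y e, y (A.partner m e))

lemma continuous_prefixCircuit (m : ℕ) (h : m ≤ d) :
    Continuous fun g => A.prefixCircuit g m h := by
  induction m with
  | zero => exact continuous_const
  | succ m ih => exact (A.continuous_layer _).mul (ih _)

lemma continuous_evolve (m : ℕ) (h : m ≤ d) (O : Op n) :
    Continuous fun g => A.evolve g m h O :=
  ((A.continuous_prefixCircuit m h).star.mul continuous_const).mul (A.continuous_prefixCircuit m h)

lemma integrable_of_continuous {f : (A.Gate → TwoQubitGate) → ℝ} (hf : Continuous f) :
    Integrable f A.haarEnsemble :=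
  hf.integrable_of_hasCompactSupport (HasCompactSupport.of_compactSpace f)

instance : haarGate.IsMulLeftInvariant := by
  unfold haarGate
  infer_instance

instance : A.haarEnsemble.IsMulLeftInvariant := by
  unfold haarEnsemble
  infer_instance

/-- The expectation of an observable in the state obtained from `|0…0⟩` by the first `m` layers.
The real part loses nothing for Hermitian observables, see `ofReal_expect`. -/
noncomputable def expect (g : A.Gate → TwoQubitGate) (m : ℕ) (h : m ≤ d) (O : Op n) : ℝ :=
  (A.evolve g m h O 0 0).re

lemma continuous_expect (m : ℕ) (h : m ≤ d) (O : Op n) :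
    Continuous fun g => A.expect g m h O :=
  Complex.continuous_re.comp ((A.continuous_evolve m h O).matrix_elem 0 0)

lemma ofReal_expect (g : A.Gate → TwoQubitGate) (m : ℕ) (h : m ≤ d) {O : Op n}
    (hO : star O = O) : (A.expect g m h O : ℂ) = A.evolve g m h O 0 0 := by
  refine Complex.conj_eq_iff_re.mp ?_
  have : star (A.evolve g m h O) = A.evolve g m h O := by
    simp only [evolve, star_mul, star_star, hO, mul_assoc]
  exact congrFun (congrFun this 0) 0

lemma prefixCircuit_congr {g g' : A.Gate → TwoQubitGate} (m : ℕ) (h : m ≤ d)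
    (hg : ∀ e : A.Gate, (e.1 : ℕ) < m → g e = g' e) :
    A.prefixCircuit g m h = A.prefixCircuit g' m h := by
  induction m with
  | zero => rfl
  | succ m ih =>
    rw [prefixCircuit, prefixCircuit, ih _ fun e he => hg e (he.trans (Nat.lt_succ_self m))]
    congr 1
    rw [layer_eq_pairTensor, layer_eq_pairTensor]
    congr 1
    funext e
    rw [hg ⟨⟨m, h⟩, e⟩ (Nat.lt_succ_self m)]

lemma star_gateOp (m : Fin d) (e : A.LayerGate m) (M : PairOp) :
    star (A.gateOp m e M) = A.gateOp m e (star M) := by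
  rw [gateOp_apply, gateOp_apply, star_pairTensor]
  congr 1
  funext f
  by_cases hf : f = e
  · subst hf; simp
  · simp [Pi.mulSingle_eq_of_ne hf]

/-- Second moment of the expectation of an observable after `m` layers. -/
noncomputable def secondMoment (m : ℕ) (h : m ≤ d) (O : Op n) : ℝ :=
  ∫ g, A.expect g m h O ^ 2 ∂A.haarEnsemble

lemma secondMoment_nonneg (m : ℕ) (h : m ≤ d) (O : Op n) : 0 ≤ A.secondMoment m h O :=
  integral_nonneg fun _ => sq_nonneg _

lemma secondMoment_one (m : ℕ) (h : m ≤ d) : A.secondMoment m h 1 = 1 := by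
  simp [secondMoment, expect, evolve_one]

/-- Heisenberg evolution through the layer `m` of an operator on one pair. -/
lemma expect_succ_gateOp (g : A.Gate → TwoQubitGate) (m : ℕ) (h : m + 1 ≤ d)
    (e : A.LayerGate ⟨m, h⟩) (M : PairOp) :
    A.expect g (m + 1) h (A.gateOp ⟨m, h⟩ e M) = A.expect g m (Nat.le_of_succ_le h)
      (A.gateOp ⟨m, h⟩ e (star (g ⟨_, e⟩ : PairOp) * M * (g ⟨_, e⟩ : PairOp))) := by
  rw [expect, evolve_succ, star_layer_mul_gateOp_mul_layer, expect]

/-- By invariance of the Haar measure, conjugating an operator on a pair of the last layer does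
not change its second moment. -/
lemma secondMoment_conj (m : ℕ) (h : m + 1 ≤ d) (e : A.LayerGate ⟨m, h⟩) (M : PairOp)
    (w : TwoQubitGate) :
    A.secondMoment (m + 1) h (A.gateOp ⟨m, h⟩ e (star (w : PairOp) * M * (w : PairOp))) =
      A.secondMoment (m + 1) h (A.gateOp ⟨m, h⟩ e M) := by
  classical
  unfold secondMoment
  -- the gate at `e` is multiplied by `w` from the left
  rw [← integral_mul_left_eq_self (fun g => A.expect g (m + 1) h (A.gateOp ⟨m, h⟩ e M) ^ 2)
    (Pi.mulSingle (⟨⟨m, h⟩, e⟩ : A.Gate) w)]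
  refine integral_congr_ae (Eventually.of_forall fun g => ?_)
  simp only
  rw [expect_succ_gateOp, expect_succ_gateOp]
  have h1 : A.prefixCircuit (Pi.mulSingle (⟨⟨m, h⟩, e⟩ : A.Gate) w * g) m (Nat.le_of_succ_le h) =
      A.prefixCircuit g m (Nat.le_of_succ_le h) := by
    refine A.prefixCircuit_congr m _ fun f hf => ?_
    have : f ≠ ⟨⟨m, h⟩, e⟩ := by rintro rfl; exact lt_irrefl _ hf
    rw [Pi.mul_apply, Pi.mulSingle_eq_of_ne this, one_mul]
  rw [expect, expect, evolve, evolve, h1]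
  simp only [Pi.mul_apply, Pi.mulSingle_eq_same, Submonoid.coe_mul, star_mul, mul_assoc]

/-- Recursion for the second moments: a Haar random gate spreads a nontrivial Pauli operator on
its pair uniformly over the fifteen nontrivial Pauli operators on this pair. -/
lemma fifteen_mul_secondMoment (m : ℕ) (h : m + 1 ≤ d) (e : A.LayerGate ⟨m, h⟩)
    {p : Fin 4 × Fin 4} (hp : p ≠ 0) :
    15 * A.secondMoment (m + 1) h (A.gateOp ⟨m, h⟩ e (pauliPair p)) =
      ∑ q ∈ Finset.univ.erase 0,
        A.secondMoment m (Nat.le_of_succ_le h) (A.gateOp ⟨m, h⟩ e (pauliPair q)) := by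
  -- all nontrivial Pauli operators are unitarily conjugate
  have hconst : ∀ q ∈ (Finset.univ : Finset (Fin 4 × Fin 4)).erase 0,
      A.secondMoment (m + 1) h (A.gateOp ⟨m, h⟩ e (pauliPair q)) =
        A.secondMoment (m + 1) h (A.gateOp ⟨m, h⟩ e (pauliPair p)) := by
    have step : ∀ q r : Fin 4 × Fin 4, pauliSign q.1 r.1 * pauliSign q.2 r.2 = -1 →
        A.secondMoment (m + 1) h (A.gateOp ⟨m, h⟩ e (pauliPair r)) =
          A.secondMoment (m + 1) h (A.gateOp ⟨m, h⟩ e (pauliPair q)) := by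
      intro q r hqr
      obtain ⟨w, hw⟩ := exists_unitary_conj (star_pauliPair q) (star_pauliPair r)
        (pauliPair_mul_self q) (pauliPair_mul_self r) (pauliPair_anticomm hqr)
      rw [← hw, secondMoment_conj]
    intro q hq
    obtain ⟨r, h1, h2⟩ := exists_pauliSign p q hp (Finset.ne_of_mem_erase hq)
    rw [step r q h2, step p r h1]
  -- for fixed gates, the total over all Pauli operators on the pair is preserved by the layer
  have hpoint : ∀ g, ∑ q, A.expect g (m + 1) h (A.gateOp ⟨m, h⟩ e (pauliPair q)) ^ 2 =
      ∑ q, A.expect g m (Nat.le_of_succ_le h) (A.gateOp ⟨m, h⟩ e (pauliPair q)) ^ 2 := by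
    intro g
    let φ : PairOp →ₗ[ℂ] ℂ :=
      { toFun := fun M => A.evolve g m (Nat.le_of_succ_le h) (A.gateOp ⟨m, h⟩ e M) 0 0
        map_add' := fun M N => by simp only [evolve, map_add, mul_add, add_mul, Matrix.add_apply]
        map_smul' := fun c M => by
          simp only [evolve, map_smul, mul_smul_comm, smul_mul_assoc, Matrix.smul_apply,
            RingHom.id_apply] }
    have hself : ∀ q, star (A.gateOp ⟨m, h⟩ e (pauliPair q)) = A.gateOp ⟨m, h⟩ e (pauliPair q) :=
      fun q => by rw [star_gateOp, star_pauliPair]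
    have := sum_sq_conj_pauliPair φ (g ⟨_, e⟩)
    rw [← Complex.ofReal_inj]
    push_cast
    simp only [A.ofReal_expect _ _ _ (hself _)]
    simp only [evolve_succ, star_layer_mul_gateOp_mul_layer]
    exact this
  have hsum : ∑ q, A.secondMoment (m + 1) h (A.gateOp ⟨m, h⟩ e (pauliPair q)) =
      ∑ q, A.secondMoment m (Nat.le_of_succ_le h) (A.gateOp ⟨m, h⟩ e (pauliPair q)) := by
    unfold secondMoment
    rw [← integral_finsetSum, ← integral_finsetSum]
    · simp only [hpoint]
    · exact fun q _ => A.integrable_of_continuous ((A.continuous_expect _ _ _).pow 2)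
    · exact fun q _ => A.integrable_of_continuous ((A.continuous_expect _ _ _).pow 2)
  -- the identity contributes `1` to both sides
  rw [← Finset.add_sum_erase _ _ (Finset.mem_univ 0), ← Finset.add_sum_erase _ _
    (Finset.mem_univ 0), pauliPair_zero, map_one, secondMoment_one, secondMoment_one,
    Finset.sum_congr rfl hconst] at hsum
  simpa [Finset.card_erase_of_mem] using hsum

/-- The second moment of `⟨Z_i⟩` after `m` layers is at least `(2 / 15) ^ m`: the contributions of
the two single-qubit `Z` operators alone give the factor `2 / 15` per layer. -/
lemma secondMoment_Z_ge (m : ℕ) (h : m ≤ d) (i : Fin n) :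
    (2 / 15 : ℝ) ^ m ≤ A.secondMoment m h (siteOp i (pauli 3)) := by
  induction m generalizing i with
  | zero =>
    simp [secondMoment, expect, evolve, prefixCircuit, siteOp, pauli]
  | succ m ih =>
    set e := A.pairOf ⟨m, h⟩ i
    have h1 : A.gateOp ⟨m, h⟩ e (pauliPair (3, 0)) = siteOp (e : Fin n) (pauli 3) := by
      rw [pauliPair, pauli_zero, gateOp_kronecker_one]
    have h2 : A.gateOp ⟨m, h⟩ e (pauliPair (0, 3)) = siteOp (A.partner ⟨m, h⟩ e) (pauli 3) := by
      rw [pauliPair, pauli_zero, gateOp_one_kronecker]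
    obtain ⟨p, hp, hpi⟩ : ∃ p ≠ 0, A.gateOp ⟨m, h⟩ e (pauliPair p) = siteOp i (pauli 3) := by
      rcases A.pairOf_cases ⟨m, h⟩ i with hi | hi
      · exact ⟨(3, 0), by decide, h1.trans (by rw [← hi])⟩
      · exact ⟨(0, 3), by decide, h2.trans (by rw [← hi])⟩
    have h15 := A.fifteen_mul_secondMoment m h e hp
    have hsub : ({(3, 0), (0, 3)} : Finset (Fin 4 × Fin 4)) ⊆ Finset.univ.erase 0 := by decide
    have hle := Finset.sum_le_sum_of_subset_of_nonneg hsub fun q _ _ =>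
      A.secondMoment_nonneg m (Nat.le_of_succ_le h) (A.gateOp ⟨m, h⟩ e (pauliPair q))
    rw [Finset.sum_pair (by decide), ← h15, h1, h2, hpi] at hle
    have h3 := ih (Nat.le_of_succ_le h) (e : Fin n)
    have h4 := ih (Nat.le_of_succ_le h) (A.partner ⟨m, h⟩ e)
    rw [pow_succ]
    linarith

end ParallelArchitecture

/-! ### Bit flips -/

lemma bit_eq_add_iff {ι : Type*} {x y b : ι → Fin 2} : x = y + b ↔ y = x + b := by
  have h : ∀ u v w : Fin 2, u = v + w ↔ v = u + w := by decide
  simp only [funext_iff, Pi.add_apply, h]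

/-- The two-qubit gate that flips the bits marked by `c`. -/
def flipGate (c : Fin 2 × Fin 2) : TwoQubitGate :=
  ⟨Matrix.of fun x y => if x = y + c then 1 else 0, by
    rw [Matrix.mem_unitaryGroup_iff]
    have h : ∀ x y : Fin 2 × Fin 2, x = y + c ↔ y = x + c := by revert c; decide
    have h' : ∀ x : Fin 2 × Fin 2, x + c + c = x := fun x => ((h (x + c) x).mp rfl).symm
    ext x y
    simp only [Matrix.mul_apply, Matrix.of_apply, Matrix.star_apply, h x, apply_ite star,
      star_one, star_zero, ite_mul, one_mul, zero_mul, Finset.sum_ite_eq', Finset.mem_univ,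
      if_true, h', Matrix.one_apply, eq_comm (a := y)]⟩

/-- `√q + √(1 - q) ≤ √2 (1 - z² / 8)` for `q = (1 + z) / 2`. -/
lemma sqrt_add_sqrt_one_sub_le {q : ℝ} (h0 : 0 ≤ q) (h1 : q ≤ 1) :
    √q + √(1 - q) ≤ √2 * (1 - (2 * q - 1) ^ 2 / 8) := by
  have hz : (2 * q - 1) ^ 2 ≤ 1 := by nlinarith
  have hprod : √q * √(1 - q) ≤ (1 - (2 * q - 1) ^ 2 / 2) / 2 := by
    rw [← Real.sqrt_mul h0]
    refine Real.sqrt_le_iff.mpr ⟨by linarith, ?_⟩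
    nlinarith [sq_nonneg ((2 * q - 1) ^ 2)]
  refine abs_le_of_sq_le_sq' ?_ (mul_nonneg (Real.sqrt_nonneg _) (by linarith)) |>.2
  rw [add_sq, mul_pow, Real.sq_sqrt h0, Real.sq_sqrt (sub_nonneg.mpr h1),
    Real.sq_sqrt (by norm_num)]
  nlinarith [sq_nonneg ((2 * q - 1) ^ 2)]

namespace ParallelArchitecture

variable {n d : ℕ} (A : ParallelArchitecture n d)

/-- Multiplying the gates of the last layer by bit flips permutes the rows of the circuit
unitary. -/
lemma exists_circuit_flip (hd : 1 ≤ d) (b : Fin n → Fin 2) :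
    ∃ w : A.Gate → TwoQubitGate, ∀ g x y, A.circuit (w * g) x y = A.circuit g (x + b) y := by
  obtain ⟨m, rfl⟩ : ∃ m, d = m + 1 := ⟨d - 1, by omega⟩
  let w : A.Gate → TwoQubitGate := fun e =>
    if (e.1 : ℕ) < m then 1 else flipGate (b e.2, b (A.partner e.1 e.2))
  refine ⟨w, fun g x y => ?_⟩
  have hm : ¬ ((⟨m, m.lt_succ_self⟩ : Fin (m + 1)) : ℕ) < m := lt_irrefl m
  have hpre : A.prefixCircuit (w * g) m m.le_succ = A.prefixCircuit g m m.le_succ :=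
    A.prefixCircuit_congr m _ fun e he => by simp [w, he]
  have hlayer : A.layer (w * g) ⟨m, m.lt_succ_self⟩ =
      (Matrix.of fun x y => if x = y + b then 1 else 0 : Op n) * A.layer g ⟨m, m.lt_succ_self⟩ := by
    have hflip : (Matrix.of fun x y => if x = y + b then 1 else 0 : Op n) =
        A.pairTensor ⟨m, m.lt_succ_self⟩ fun e => (w ⟨⟨m, m.lt_succ_self⟩, e⟩ : PairOp) := by
      ext x y
      have : ∀ e : A.LayerGate ⟨m, m.lt_succ_self⟩, (w ⟨⟨m, m.lt_succ_self⟩, e⟩ : PairOp)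
          (A.pairEquiv ⟨m, m.lt_succ_self⟩ x e) (A.pairEquiv ⟨m, m.lt_succ_self⟩ y e) =
          if A.pairEquiv ⟨m, m.lt_succ_self⟩ x e = A.pairEquiv ⟨m, m.lt_succ_self⟩ (y + b) e
            then 1 else 0 := by
        intro e
        simp only [w, hm, if_false]
        rfl
      simp only [pairTensor_apply, this, Finset.prod_ite_zero, Finset.prod_const_one,
        Finset.mem_univ, true_implies, Matrix.of_apply]
      congr 1
      rw [← funext_iff, Equiv.apply_eq_iff_eq]
    rw [hflip, layer_eq_pairTensor, layer_eq_pairTensor, ← map_mul]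
    rfl
  rw [← prefixCircuit_eq_circuit, ← prefixCircuit_eq_circuit, prefixCircuit, prefixCircuit, hpre,
    hlayer, mul_assoc, Matrix.mul_apply]
  simp only [Matrix.of_apply, bit_eq_add_iff, ite_mul, one_mul, zero_mul, Finset.sum_ite_eq',
    Finset.mem_univ, if_true]

/-! ### Marginal output probabilities -/

/-- The probability of the output `x`. -/
noncomputable def outputProb (g : A.Gate → TwoQubitGate) (x : Fin n → Fin 2) : ℝ :=
  ‖A.circuit g x 0‖ ^ 2

lemma outputProb_nonneg (g : A.Gate → TwoQubitGate) (x : Fin n → Fin 2) :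
    0 ≤ A.outputProb g x := sq_nonneg _

lemma continuous_outputProb (x : Fin n → Fin 2) : Continuous fun g => A.outputProb g x := by
  unfold outputProb
  simp only [← prefixCircuit_eq_circuit]
  exact ((A.continuous_prefixCircuit d le_rfl).matrix_elem x 0).norm.pow 2

lemma evolve_diagonal_apply_zero (g : A.Gate → TwoQubitGate) (f : (Fin n → Fin 2) → ℝ) :
    A.evolve g d le_rfl (Matrix.diagonal fun x => (f x : ℂ)) 0 0 =
      ((∑ x, f x * A.outputProb g x : ℝ) : ℂ) := by
  rw [evolve, prefixCircuit_eq_circuit, Matrix.mul_apply]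
  push_cast
  refine Finset.sum_congr rfl fun x _ => ?_
  rw [Matrix.mul_diagonal, Matrix.star_apply, mul_right_comm, mul_comm, outputProb]
  push_cast
  rw [← Complex.conj_mul']
  rfl

lemma sum_outputProb (g : A.Gate → TwoQubitGate) : ∑ x, A.outputProb g x = 1 := by
  have h := A.evolve_diagonal_apply_zero g fun _ => 1
  rw [Complex.ofReal_one, Matrix.diagonal_one, evolve_one, Matrix.one_apply_eq] at h
  simpa using (Complex.ofReal_injective h.symm)

/-- The probability that the outputs of all qubits in `S` are `0`. -/
noncomputable def marginal (S : Finset (Fin n)) (g : A.Gate → TwoQubitGate) : ℝ :=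
  ∑ x, (if ∀ i ∈ S, x i = 0 then 1 else 0) * A.outputProb g x

lemma continuous_marginal (S : Finset (Fin n)) : Continuous (A.marginal S) :=
  continuous_finsetSum _ fun x _ => continuous_const.mul (A.continuous_outputProb x)

lemma marginal_nonneg (S : Finset (Fin n)) (g : A.Gate → TwoQubitGate) : 0 ≤ A.marginal S g :=
  Finset.sum_nonneg fun x _ =>
    mul_nonneg (by split_ifs <;> norm_num) (A.outputProb_nonneg g x)

lemma marginal_empty (g : A.Gate → TwoQubitGate) : A.marginal ∅ g = 1 := by
  simp [marginal, sum_outputProb]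

/-- The projection onto the states in which all qubits of `S` are `0`. -/
noncomputable def zeroProj (S : Finset (Fin n)) : Op n :=
  Matrix.diagonal fun x => (((if ∀ i ∈ S, x i = 0 then 1 else 0 : ℝ)) : ℂ)

lemma isSupportedOn_zeroProj (S : Finset (Fin n)) : IsSupportedOn S (zeroProj S) := by
  refine isSupportedOn_diagonal _ fun x y h => ?_
  have : (∀ i ∈ S, x i = 0) ↔ ∀ i ∈ S, y i = 0 :=
    forall₂_congr fun i hi => by rw [h i hi]
  simp only [this]

lemma ofReal_marginal (S : Finset (Fin n)) (g : A.Gate → TwoQubitGate) :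
    (A.marginal S g : ℂ) = A.evolve g d le_rfl (zeroProj S) 0 0 :=
  (A.evolve_diagonal_apply_zero g _).symm

lemma marginal_congr {S : Finset (Fin n)} {g g' : A.Gate → TwoQubitGate}
    (hg : ∀ e : A.Gate, (e.2 : Fin n) ∈ A.cone d le_rfl S → g e = g' e) :
    A.marginal S g = A.marginal S g' := by
  rw [← Complex.ofReal_inj, ofReal_marginal, ofReal_marginal,
    A.evolve_congr (isSupportedOn_zeroProj S) d le_rfl hg]

lemma marginal_insert {i : Fin n} {S : Finset (Fin n)}
    (h : ∀ s ∈ S, Disjoint (A.cone d le_rfl {i}) (A.cone d le_rfl {s}))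
    (g : A.Gate → TwoQubitGate) :
    A.marginal (insert i S) g = A.marginal {i} g * A.marginal S g := by
  have hmul : zeroProj (insert i S) = zeroProj {i} * zeroProj S := by
    rw [zeroProj, zeroProj, zeroProj, Matrix.diagonal_mul_diagonal]
    congr 1
    funext x
    rw [← Complex.ofReal_mul]
    simp only [Finset.forall_mem_insert, Finset.mem_singleton, forall_eq]
    by_cases hx : x i = 0 <;> simp [hx]
  have hdisj : Disjoint (A.cone d le_rfl {i}) (A.cone d le_rfl S) := by
    refine Finset.disjoint_right.mpr fun j hj => ?_
    obtain ⟨s, hs, hj⟩ := (A.mem_cone_iff d le_rfl S j).mp hj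
    exact Finset.disjoint_right.mp (h s hs) hj
  rw [← Complex.ofReal_inj, Complex.ofReal_mul, ofReal_marginal, ofReal_marginal, ofReal_marginal,
    hmul, evolve_mul]
  exact (A.isSupportedOn_evolve (isSupportedOn_zeroProj _) g d le_rfl).mul_apply_zero
    (A.isSupportedOn_evolve (isSupportedOn_zeroProj _) g d le_rfl) hdisj

lemma expect_Z (i : Fin n) (g : A.Gate → TwoQubitGate) :
    A.expect g d le_rfl (siteOp i (pauli 3)) = 2 * A.marginal {i} g - 1 := by
  have hZ : (siteOp i (pauli 3) : Op n) =
      Matrix.diagonal fun x => ((2 * (if x i = 0 then 1 else 0) - 1 : ℝ) : ℂ) := by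
    ext x y
    rw [siteOp, Matrix.of_apply, Matrix.diagonal_apply]
    by_cases hxy : x = y
    · subst hxy
      rw [if_pos (fun _ _ => rfl), if_pos rfl]
      obtain h | h : x i = 0 ∨ x i = 1 := by generalize x i = t; revert t; decide
      · rw [h]; simp [pauli]; norm_num
      · rw [h]; simp [pauli]
    · rw [if_neg hxy]
      split_ifs with h
      · have hi : x i ≠ y i := fun hi => hxy <| funext fun k => by
          by_cases hk : k = i
          · rw [hk, hi]
          · exact h k hk
        generalize x i = s at hi
        generalize y i = t at hi
        revert hi
        fin_cases s <;> fin_cases t <;> simp [pauli]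
      · rfl
  rw [expect, hZ, evolve_diagonal_apply_zero, Complex.ofReal_re, marginal, Finset.mul_sum]
  simp only [sub_mul, one_mul, Finset.sum_sub_distrib, A.sum_outputProb, Finset.mem_singleton,
    forall_eq, mul_assoc]

/-! ### Independence and the mean of the square root -/

/-- Functions of disjoint sets of gates are independent. -/
lemma integral_mul_of_disjoint {f f' : (A.Gate → TwoQubitGate) → ℝ} {G G' : Finset A.Gate}
    (hf : Continuous f) (hf' : Continuous f') (hG : DependsOn f G) (hG' : DependsOn f' G')
    (hdisj : Disjoint G G') :
    ∫ g, f g * f' g ∂A.haarEnsemble =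
      (∫ g, f g ∂A.haarEnsemble) * ∫ g, f' g ∂A.haarEnsemble := by
  classical
  have hind : ProbabilityTheory.iIndepFun (fun e (g : A.Gate → TwoQubitGate) => g e)
      A.haarEnsemble :=
    ProbabilityTheory.iIndepFun_pi (X := fun _ => id) fun _ => aemeasurable_id
  have hind2 := hind.indepFun_finset G G' hdisj fun e => measurable_pi_apply e
  have key : ∀ (F : (A.Gate → TwoQubitGate) → ℝ) (H : Finset A.Gate), Continuous F →
      DependsOn F H → ∃ φ : (H → TwoQubitGate) → ℝ, Measurable φ ∧
        F = φ ∘ fun (g : A.Gate → TwoQubitGate) (e : H) => g e := by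
    intro F H hF hH
    refine ⟨fun c => F fun e => if he : e ∈ H then c ⟨e, he⟩ else 1, ?_, ?_⟩
    · refine hF.measurable.comp (measurable_pi_lambda _ fun e => ?_)
      by_cases he : e ∈ H
      · simpa only [he, dif_pos] using measurable_pi_apply _
      · simpa only [he, dif_neg, not_false_eq_true] using measurable_const
    · funext g
      refine hH fun e he => ?_
      simp [Finset.mem_coe.mp he]
  obtain ⟨φ, hφ, hfφ⟩ := key f G hf hG
  obtain ⟨φ', hφ', hfφ'⟩ := key f' G' hf' hG'
  have hind3 := hind2.comp hφ hφ'
  rw [← hfφ, ← hfφ'] at hind3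
  exact hind3.integral_fun_mul_eq_mul_integral hf.measurable.aestronglyMeasurable
    hf'.measurable.aestronglyMeasurable

/-- For qubits with disjoint light cones, the marginal probability is a product of independent
single-qubit probabilities. -/
lemma integral_sqrt_marginal {S : Finset (Fin n)}
    (hS : (S : Set (Fin n)).PairwiseDisjoint fun i => A.cone d le_rfl {i}) :
    ∫ g, √(A.marginal S g) ∂A.haarEnsemble =
      ∏ i ∈ S, ∫ g, √(A.marginal {i} g) ∂A.haarEnsemble := by
  classical
  induction S using Finset.induction_on with
  | empty => simp [marginal_empty]
  | insert i S hi ih =>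
    rw [Finset.coe_insert] at hS
    have hdisj : ∀ s ∈ S, Disjoint (A.cone d le_rfl {i}) (A.cone d le_rfl {s}) := fun s hs =>
      hS (Set.mem_insert _ _) (Set.mem_insert_of_mem _ hs) fun h => hi (h ▸ hs)
    have hcont : ∀ T, Continuous fun g => √(A.marginal T g) := fun T =>
      (A.continuous_marginal T).sqrt
    have hdep : ∀ T : Finset (Fin n), DependsOn (fun g => √(A.marginal T g))
        ((Finset.univ.filter fun e : A.Gate => (e.2 : Fin n) ∈ A.cone d le_rfl T :
          Finset A.Gate) : Set A.Gate) := fun T g g' hg =>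
      congrArg _ (A.marginal_congr fun e he => hg e (by simpa using he))
    rw [Finset.prod_insert hi, ← ih (hS.subset (Set.subset_insert _ _)),
      ← A.integral_mul_of_disjoint (hcont _) (hcont _) (hdep {i}) (hdep S)]
    · refine integral_congr_ae (Eventually.of_forall fun g => ?_)
      simp only
      rw [A.marginal_insert hdisj, Real.sqrt_mul (A.marginal_nonneg _ _)]
    · refine Finset.disjoint_left.mpr fun e he he' => ?_
      simp only [Finset.mem_filter, Finset.mem_univ, true_and] at he he'
      obtain ⟨s, hs, hj⟩ := (A.mem_cone_iff d le_rfl S _).mp he'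
      exact Finset.disjoint_left.mp (hdisj s hs) he hj

lemma marginal_flip {w g : A.Gate → TwoQubitGate} {i : Fin n}
    (hw : ∀ x y, A.circuit (w * g) x y = A.circuit g (x + Pi.single i 1) y) :
    A.marginal {i} (w * g) = 1 - A.marginal {i} g := by
  have h : A.marginal {i} (w * g) =
      ∑ x, (if x i = 0 then 0 else 1) * A.outputProb g x := by
    unfold marginal
    rw [← Equiv.sum_comp (Equiv.addRight (Pi.single i 1 : Fin n → Fin 2)) fun x =>
      (if x i = 0 then 0 else 1) * A.outputProb g x]
    refine Finset.sum_congr rfl fun x _ => ?_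
    simp only [outputProb, hw, Equiv.coe_addRight, Finset.mem_singleton, forall_eq, Pi.add_apply,
      Pi.single_eq_same]
    congr 1
    generalize x i = t
    fin_cases t <;> simp
  rw [h, eq_sub_iff_add_eq, marginal, ← Finset.sum_add_distrib]
  refine (Finset.sum_congr rfl fun x _ => ?_).trans (A.sum_outputProb g)
  simp only [Finset.mem_singleton, forall_eq]
  split_ifs <;> ring

lemma integral_sqrt_marginal_singleton_le (hd : 1 ≤ d) (i : Fin n) :
    ∫ g, √(A.marginal {i} g) ∂A.haarEnsemble ≤ √2 / 2 * (1 - (2 / 15) ^ d / 8) := by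
  obtain ⟨w, hw⟩ := A.exists_circuit_flip hd (Pi.single i 1)
  have hsymm : ∫ g, √(A.marginal {i} g) ∂A.haarEnsemble =
      ∫ g, √(1 - A.marginal {i} g) ∂A.haarEnsemble := by
    rw [← integral_mul_left_eq_self (fun g => √(A.marginal {i} g)) w]
    simp only [A.marginal_flip (hw _)]
  have hc := A.continuous_marginal {i}
  have hle1 : ∀ g, A.marginal {i} g ≤ 1 := fun g => by
    have := A.marginal_nonneg {i} (w * g)
    rw [A.marginal_flip (hw _)] at this
    linarith
  have hI1 := A.integrable_of_continuous hc.sqrt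
  have hI2 : Integrable (fun g => √(1 - A.marginal {i} g)) A.haarEnsemble :=
    A.integrable_of_continuous (by fun_prop)
  have hI3 : Integrable (fun g => (2 * A.marginal {i} g - 1) ^ 2) A.haarEnsemble :=
    A.integrable_of_continuous (by fun_prop)
  have hsum : (∫ g, √(A.marginal {i} g) ∂A.haarEnsemble) +
      ∫ g, √(1 - A.marginal {i} g) ∂A.haarEnsemble ≤
      ∫ g, √2 * (1 - (2 * A.marginal {i} g - 1) ^ 2 / 8) ∂A.haarEnsemble := by
    rw [← integral_add hI1 hI2]
    exact integral_mono (hI1.add hI2) (((integrable_const 1).sub (hI3.div_const 8)).const_mul _)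
      fun g => sqrt_add_sqrt_one_sub_le (A.marginal_nonneg _ g) (hle1 g)
  have hv := A.secondMoment_Z_ge d le_rfl i
  simp only [secondMoment, expect_Z] at hv
  rw [← hsymm, integral_const_mul, integral_sub (integrable_const 1) (hI3.div_const 8),
    integral_div, integral_const, probReal_univ, one_smul] at hsum
  nlinarith [Real.sqrt_nonneg 2, mul_le_mul_of_nonneg_left hv (Real.sqrt_nonneg 2)]

/-- By invariance under bit flips and concavity of the square root, the probability of a single
output string is, for the mean of the square root, at most the marginal probability divided by
the number of completions. -/
lemma sqrt_two_pow_mul_integral_sqrt_zeroProb_le (hd : 1 ≤ d) (S : Finset (Fin n)) :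
    √(2 ^ (n - S.card)) * ∫ g, √(A.zeroProb g) ∂A.haarEnsemble ≤
      ∫ g, √(A.marginal S g) ∂A.haarEnsemble := by
  classical
  set B : Finset (Fin n → Fin 2) := Finset.univ.filter fun x => ∀ i ∈ S, x i = 0 with hB
  have hcard : B.card = 2 ^ (n - S.card) := by
    have : B = Fintype.piFinset fun i => if i ∈ S then {0} else Finset.univ := by
      ext x
      simp only [hB, Finset.mem_filter, Finset.mem_univ, true_and, Fintype.mem_piFinset]
      refine forall_congr' fun i => ?_
      by_cases hi : i ∈ S <;> simp [hi]
    rw [this, Fintype.card_piFinset]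
    simp only [apply_ite Finset.card, Finset.card_singleton, Finset.card_univ, Fintype.card_fin]
    rw [Finset.prod_ite]
    simp [Finset.filter_not, Finset.card_sdiff]
  have hflip : ∀ b, ∫ g, √(A.outputProb g b) ∂A.haarEnsemble =
      ∫ g, √(A.zeroProb g) ∂A.haarEnsemble := by
    intro b
    obtain ⟨w, hw⟩ := A.exists_circuit_flip hd b
    rw [← integral_mul_left_eq_self (fun g => √(A.zeroProb g)) w]
    simp only [zeroProb, hw, zero_add]
    rfl
  have hcont : ∀ b, Continuous fun g => √(A.outputProb g b) := fun b =>
    (A.continuous_outputProb b).sqrt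
  have hpoint : ∀ g, ∑ b ∈ B, √(A.outputProb g b) ≤
      √(2 ^ (n - S.card)) * √(A.marginal S g) := by
    intro g
    have h1 := Real.sum_sqrt_mul_sqrt_le B (f := fun _ => 1) (g := A.outputProb g)
      (fun _ => zero_le_one) (A.outputProb_nonneg g)
    have h2 : ∑ b ∈ B, A.outputProb g b = A.marginal S g := by
      rw [hB, Finset.sum_filter, marginal]
      simp only [ite_mul, one_mul, zero_mul]
    simpa [h2, hcard] using h1
  have hcS : Continuous fun g => √(2 ^ (n - S.card)) * √(A.marginal S g) :=
    continuous_const.mul (A.continuous_marginal S).sqrt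
  have hint := integral_mono (A.integrable_of_continuous
    (continuous_finsetSum B fun b _ => hcont b)) (A.integrable_of_continuous hcS) hpoint
  rw [integral_finsetSum _ fun b _ => A.integrable_of_continuous (hcont b),
    integral_const_mul, Finset.sum_congr rfl fun b _ => hflip b, Finset.sum_const, hcard,
    nsmul_eq_mul] at hint
  push_cast at hint
  have hpos : 0 < √(2 ^ (n - S.card) : ℝ) := Real.sqrt_pos.mpr (by positivity)
  refine le_of_mul_le_mul_left ?_ hpos
  rwa [← mul_assoc, Real.mul_self_sqrt (by positivity)]

lemma integral_sqrt_zeroProb_le (hd : 1 ≤ d) :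
    ∫ g, √(2 ^ n * A.zeroProb g) ∂A.haarEnsemble ≤ Real.exp (-(n / (8 * 30 ^ d))) := by
  obtain ⟨S, hn, hS⟩ := A.exists_disjoint_cones
  have hSn : S.card ≤ n := by simpa using S.card_le_univ
  have hv1 : ((2 : ℝ) / 15) ^ d ≤ 1 := pow_le_one₀ (by norm_num) (by norm_num)
  have h1 := A.sqrt_two_pow_mul_integral_sqrt_zeroProb_le hd S
  rw [A.integral_sqrt_marginal hS] at h1
  have h2 : ∏ i ∈ S, ∫ g, √(A.marginal {i} g) ∂A.haarEnsemble ≤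
      (√2 / 2 * (1 - (2 / 15) ^ d / 8)) ^ S.card := by
    rw [← Finset.prod_const]
    exact Finset.prod_le_prod (fun i _ => integral_nonneg fun g => Real.sqrt_nonneg _)
      fun i _ => A.integral_sqrt_marginal_singleton_le hd i
  have h3 : √(2 ^ n : ℝ) = √2 ^ S.card * √(2 ^ (n - S.card)) := by
    have h5 : √(2 ^ S.card : ℝ) = √2 ^ S.card := by
      rw [Real.sqrt_eq_iff_mul_self_eq (by positivity) (by positivity), ← mul_pow,
        Real.mul_self_sqrt (by norm_num)]
    rw [← h5, ← Real.sqrt_mul (by positivity), ← pow_add, Nat.add_sub_cancel' hSn]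
  have h4 : √2 * (√2 / 2 * (1 - (2 / 15) ^ d / 8)) = (1 - (2 / 15 : ℝ) ^ d / 8) := by
    rw [← mul_assoc, ← mul_div_assoc, Real.mul_self_sqrt (by norm_num)]
    norm_num
  simp only [Real.sqrt_mul (by positivity : (0 : ℝ) ≤ 2 ^ n), integral_const_mul]
  calc √(2 ^ n) * ∫ g, √(A.zeroProb g) ∂A.haarEnsemble
      ≤ √2 ^ S.card * (√2 / 2 * (1 - (2 / 15) ^ d / 8)) ^ S.card := by
        rw [h3, mul_assoc]
        exact mul_le_mul_of_nonneg_left (h1.trans h2) (by positivity)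
    _ = (1 - (2 / 15 : ℝ) ^ d / 8) ^ S.card := by rw [← mul_pow, h4]
    _ ≤ Real.exp (-((2 / 15 : ℝ) ^ d / 8)) ^ S.card :=
        pow_le_pow_left₀ (by linarith) (Real.one_sub_le_exp_neg _) _
    _ = Real.exp (-(S.card * ((2 / 15 : ℝ) ^ d / 8))) := by rw [← Real.exp_nat_mul, mul_neg]
    _ ≤ Real.exp (-(n / (8 * 30 ^ d))) := by
        refine Real.exp_le_exp.mpr (neg_le_neg ?_)
        have hn' : (n : ℝ) ≤ S.card * 4 ^ d := by exact_mod_cast hn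
        rw [div_le_iff₀ (by positivity)]
        calc (n : ℝ) ≤ S.card * 4 ^ d := hn'
          -- `4 * (15 / 2) = 30`
          _ = S.card * ((2 / 15) ^ d / 8) * (8 * 30 ^ d) := by
            rw [show (4 : ℝ) = 2 / 15 * 30 by norm_num, mul_pow]
            ring

/-- Markov's inequality for `√(2 ^ n p)`. -/
lemma measureReal_zeroProb_ge_le (hd : 1 ≤ d) :
    A.haarEnsemble.real {g | 1 / ((2 : ℝ) ^ n * Real.exp ((n : ℝ) / (8 * (30 : ℝ) ^ d))) ≤
      A.zeroProb g} ≤ Real.exp (-(n / 30 ^ d / 16)) := by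
  set t : ℝ := n / 30 ^ d / 16 with ht
  have ht2 : (n : ℝ) / (8 * 30 ^ d) = t + t := by rw [ht]; field_simp; ring
  have hcont : Continuous fun g => √(2 ^ n * A.zeroProb g) :=
    (continuous_const.mul (A.continuous_outputProb 0)).sqrt
  have hmarkov := mul_meas_ge_le_integral_of_nonneg (μ := A.haarEnsemble)
    (Eventually.of_forall fun g => Real.sqrt_nonneg (2 ^ n * A.zeroProb g))
    (A.integrable_of_continuous hcont) (Real.exp (-t))
  have hsub : {g | 1 / ((2 : ℝ) ^ n * Real.exp ((n : ℝ) / (8 * (30 : ℝ) ^ d))) ≤ A.zeroProb g} ⊆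
      {g | Real.exp (-t) ≤ √(2 ^ n * A.zeroProb g)} := by
    intro g hg
    rw [Set.mem_ofPred_eq, div_le_iff₀ (by positivity), ht2] at hg
    refine Real.le_sqrt_of_sq_le ?_
    rw [← Real.exp_nat_mul, Nat.cast_two, mul_neg, two_mul, Real.exp_neg,
      inv_le_iff_one_le_mul₀ (Real.exp_pos _)]
    linarith
  have h1 := (mul_le_mul_of_nonneg_left (measureReal_mono hsub) (Real.exp_pos (-t)).le).trans
    (hmarkov.trans (A.integral_sqrt_zeroProb_le hd))
  rw [ht2] at h1 ⊢
  rw [neg_add, Real.exp_add (-t) (-t)] at h1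
  exact le_of_mul_le_mul_left h1 (Real.exp_pos _)

end ParallelArchitecture

/-! ### Sublogarithmic depth -/

lemma IsSublogarithmic.tendsto_div_pow {n d : ℕ → ℕ} (hsub : IsSublogarithmic n d)
    (hn : Tendsto n atTop atTop) :
    Tendsto (fun k => (n k : ℝ) / 30 ^ d k) atTop atTop := by
  have hlog30 : 0 < Real.log 30 := Real.log_pos (by norm_num)
  have hlog : Tendsto (fun k => Real.log (n k)) atTop atTop :=
    Real.tendsto_log_atTop.comp (tendsto_natCast_atTop_atTop.comp hn)
  have hhalf : Tendsto (fun k => Real.exp (Real.log (n k) / 2)) atTop atTop :=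
    Real.tendsto_exp_atTop.comp (hlog.atTop_div_const (by norm_num))
  refine tendsto_atTop_mono' _ ?_ hhalf
  filter_upwards [hsub.bound (show 0 < 1 / (2 * Real.log 30) by positivity),
    hn.eventually_ge_atTop 1] with k hk hk1
  have hnk : (1 : ℝ) ≤ n k := by exact_mod_cast hk1
  rw [Real.norm_of_nonneg (Nat.cast_nonneg _), Real.norm_of_nonneg (Real.log_nonneg hnk),
    div_mul_eq_mul_div, one_mul, le_div_iff₀ (by positivity)] at hk
  have h30 : (30 : ℝ) ^ d k = Real.exp (d k * Real.log 30) := by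
    rw [Real.exp_nat_mul, Real.exp_log (by norm_num)]
  rw [h30]
  nth_rewrite 2 [← Real.exp_log (by linarith : (0 : ℝ) < n k)]
  rw [← Real.exp_sub]
  exact Real.exp_le_exp.mpr (by linarith)

end RandomCircuit

theorem mainTheorem3 (n d : ℕ → ℕ) (hn : Tendsto n atTop atTop)
    (hd : ∀ k, 1 ≤ d k) (hsub : RandomCircuit.IsSublogarithmic n d)
    (A : ∀ k, RandomCircuit.ParallelArchitecture (n k) (d k)) :
    Tendsto
      (fun k => (A k).haarEnsemble
        {g | 1 / ((2 : ℝ) ^ n k * Real.exp ((n k : ℝ) / (8 * (30 : ℝ) ^ d k))) ≤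
          (A k).zeroProb g})
      atTop (𝓝 0) := by
  have hlim : Tendsto (fun k => ENNReal.ofReal (Real.exp (-((n k : ℝ) / 30 ^ d k / 16))))
      atTop (𝓝 0) := by
    rw [← ENNReal.ofReal_zero]
    exact ENNReal.tendsto_ofReal (Real.tendsto_exp_neg_atTop_nhds_zero.comp
      ((hsub.tendsto_div_pow hn).atTop_div_const (by norm_num)))
  refine tendsto_of_tendsto_of_tendsto_of_le_of_le tendsto_const_nhds hlim
    (fun _ => zero_le) fun k => ?_
  rw [← ofReal_measureReal]
  exact ENNReal.ofReal_le_ofReal ((A k).measureReal_zeroProb_ge_le (hd k))
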